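/- Let $G$ be a finite group. A stem extension of $G$ is a group $E$ with a surjective homomorphism $\pi\colon E\to G$ such that $\ker\pi\subseteq Z(E)\cap[E,E]$; a Schur cover of $G$ is a stem extension of $G$ of maximal order. Every finite group has a Schur cover. The deep commuting graph $\Delta_D(G)$, computed from a Schur cover $\pi\colon\tilde G\to G$, is the simple graph with vertex set $G$ in which two distinct elements are adjacent if and only if their preimages under $\pi$ commute in $\tilde G$. Theorem. Let $\Gamma$ be a finite simple undirected graph. Then: (i) there is a finite nilpotent group $G$ such that $\Delta_D(G)$ contains an induced subgraph isomorphic to $\Gamma$; (ii) there is a finite abelian group $G_1$ such that $\Delta_D(G_1)$ contains an induced subgraph isomorphic to $\Gamma$; (iii) there is a finite non-abelian nilpotent group $G_2$ such that $\Delta_D(G_2)$ contains an induced subgraph isomorphic to $\Gamma$. In each case the assertion holds for $\Delta_D$ computed from any Schur cover of the group. -/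

import Mathlib

universe u

/-- `π : E →* G` is a stem extension of `G` (with kernel `ker π`): `π` is surjective and its kernel
lies in `Z(E) ∩ [E, E]`. -/
structure IsStemExtension {E G : Type u} [Group E] [Group G] (π : E →* G) : Prop where
  surjective : Function.Surjective π
  ker_le_center : π.ker ≤ Subgroup.center E
  ker_le_commutator : π.ker ≤ commutator E

/-- `π : E →* G` is a Schur cover of the finite group `G`: a (finite) stem extension of maximal
order among all stem extensions of `G`. -/
structure IsSchurCover {E G : Type u} [Group E] [Group G] (π : E →* G) : Prop where
  isStem : IsStemExtension π
  finite : Finite E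
  card_le : ∀ (E' : Type u) [Group E'] (π' : E' →* G),
    IsStemExtension π' → Nat.card E' ≤ Nat.card E

/-- A Schur cover of `G`, as a group `E` together with its projection `π` onto `G`. -/
structure SchurCover (G : Type u) [Group G] where
  E : Type u
  [group : Group E]
  π : E →* G
  isSchurCover : IsSchurCover π

attribute [instance] SchurCover.group

/-- The deep commuting graph of `G`, computed from the Schur cover `C` of `G`: the vertices are the
elements of `G`, and two distinct elements are adjacent iff their preimages in `C.E` commute. -/
def SchurCover.deepCommutingGraph {G : Type u} [Group G] (C : SchurCover G) : SimpleGraph G where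
  Adj x y := x ≠ y ∧ ∀ a b : C.E, C.π a = x → C.π b = y → a * b = b * a
  symm := ⟨fun _ _ h => ⟨h.1.symm, fun a b ha hb => (h.2 b a hb ha).symm⟩⟩
  loopless := ⟨fun _ h => h.1 rfl⟩

/-- The order of a stem extension of a finite group `G`, which is itself finite, is bounded in terms
of the order of `G`. -/
theorem IsStemExtension.finite_and_card_le {E G : Type u} [Group E] [Group G] [Finite G]
    {π : E →* G} (h : IsStemExtension π) :
    Finite E ∧ Nat.card E ≤ (∑ n ∈ Finset.range (Nat.card (G × G) + 1),
      Subgroup.cardCommutatorBound n) * Nat.card G := by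
  obtain ⟨s, hs⟩ := h.surjective.hasRightInverse
  have key : ∀ a : E, ∃ z ∈ Subgroup.center E, a = s (π a) * z := fun a =>
    ⟨(s (π a))⁻¹ * a, h.ker_le_center (by simp [MonoidHom.mem_ker, hs (π a)]), by group⟩
  have hsub : commutatorSet E ⊆ Set.range (fun p : G × G =>
      s p.1 * s p.2 * (s p.1)⁻¹ * (s p.2)⁻¹) := by
    rintro _ ⟨a, b, rfl⟩
    refine ⟨(π a, π b), ?_⟩
    obtain ⟨z, hz, ha⟩ := key a
    obtain ⟨w, hw, hb⟩ := key b
    have hz' := Subgroup.mem_center_iff.1 hz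
    have hw' := Subgroup.mem_center_iff.1 hw
    dsimp only
    generalize s (π a) = x at *
    generalize s (π b) = y at *
    subst ha hb
    simp only [commutatorElement_def, mul_inv_rev]
    have e1 : x * z * (y * w) = x * y * (w * z) := by
      rw [mul_assoc x z, ← hz' (y * w)]; group
    have e2 : z⁻¹ * x⁻¹ * (w⁻¹ * y⁻¹) = (w * z)⁻¹ * (x⁻¹ * y⁻¹) := by
      have : x⁻¹ * w⁻¹ = w⁻¹ * x⁻¹ := by
        rw [← mul_inv_rev, ← mul_inv_rev, hw']
      calc z⁻¹ * x⁻¹ * (w⁻¹ * y⁻¹) = z⁻¹ * (x⁻¹ * w⁻¹) * y⁻¹ := by group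
        _ = _ := by rw [this]; group
    calc x * y * x⁻¹ * y⁻¹ = x * y * (w * z) * ((w * z)⁻¹ * (x⁻¹ * y⁻¹)) := by group
      _ = x * z * (y * w) * (z⁻¹ * x⁻¹ * (w⁻¹ * y⁻¹)) := by rw [e1, e2]
      _ = _ := by group
  have hfin : Finite (commutatorSet E) := (Set.finite_range _).subset hsub
  have hcs : Nat.card (commutatorSet E) ≤ Nat.card (G × G) :=
    (Nat.card_mono (Set.finite_range _) hsub).trans (Finite.card_range_le _)
  have hcomm := (Subgroup.card_commutator_le_of_finite_commutatorSet (G := E)).trans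
    (Finset.single_le_sum (f := Subgroup.cardCommutatorBound) (fun _ _ => Nat.zero_le _)
      (Finset.mem_range.2 (Nat.lt_succ_of_le hcs)))
  have hkerfin : Finite π.ker :=
    Finite.of_injective _ (Subgroup.inclusion_injective h.ker_le_commutator)
  have hker : Nat.card π.ker ≤ Nat.card (commutator E) :=
    Nat.card_le_card_of_injective _ (Subgroup.inclusion_injective h.ker_le_commutator)
  have hidx : π.ker.index = Nat.card G := by
    rw [Subgroup.index_ker, MonoidHom.range_eq_top.2 h.surjective, Subgroup.card_top]
  have hcard : Nat.card E = Nat.card π.ker * Nat.card G := by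
    rw [← hidx, Subgroup.card_mul_index]
  refine ⟨Nat.finite_of_card_ne_zero ?_, ?_⟩
  · rw [hcard]
    exact mul_ne_zero Nat.card_pos.ne' Nat.card_pos.ne'
  · rw [hcard]
    exact Nat.mul_le_mul_right _ (hker.trans hcomm)

/-- Every finite group has a Schur cover. -/
instance SchurCover.instNonempty (G : Type u) [Group G] [Finite G] : Nonempty (SchurCover G) := by
  classical
  let P : ℕ → Prop := fun n => ∃ (E : Type u) (_ : Group E) (π : E →* G),
    IsStemExtension π ∧ Nat.card E = n
  set N := (∑ n ∈ Finset.range (Nat.card (G × G) + 1),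
      Subgroup.cardCommutatorBound n) * Nat.card G with hN
  have hid : IsStemExtension (MonoidHom.id G) :=
    ⟨Function.surjective_id, fun x hx => by
      rw [MonoidHom.mem_ker, MonoidHom.id_apply] at hx
      exact hx ▸ one_mem _, fun x hx => by
      rw [MonoidHom.mem_ker, MonoidHom.id_apply] at hx
      exact hx ▸ one_mem _⟩
  have h0 : P (Nat.card G) := ⟨G, inferInstance, MonoidHom.id G, hid, rfl⟩
  obtain ⟨E, _, π, hπ, hE⟩ := Nat.findGreatest_spec (P := P) (n := N)
    hid.finite_and_card_le.2 h0
  exact ⟨⟨E, π, hπ, hπ.finite_and_card_le.1, fun E' _ π' h' => hE ▸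
    Nat.le_findGreatest h'.finite_and_card_le.2 ⟨E', inferInstance, π', h', rfl⟩⟩⟩

/-! All three groups have the form `(ℤ/N)² × H`, where `H` has trivial Schur multiplier and order
prime to `N`. In a stem extension let `x`, `y` lift the generators of `(ℤ/N)²`. Then `c = ⁅x, y⁆` is
central, and lifts of `u` and `v` have commutator `c ^ det(u, v)`. By coprimality `H` contributes
nothing to the kernel, so `c` generates it (`IsStemExtension.ker_le_zpowers`). Clearly `c ^ N = 1`;
for a Schur cover, comparison with the Heisenberg group times `H` forces order exactly `N`. Hence
lifts commute iff `det(u, v) = 0` (`IsSchurCover.mul_comm_iff`).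

It remains to encode a graph by vanishing determinants over `ℤ/N`, which the Chinese remainder
theorem does with one odd prime per ordered pair of vertices. A trivial `H` gives the abelian group,
and the quaternion group of order 8 the non-abelian nilpotent one. -/

open scoped commutatorElement

/-! ### Calculus of central commutators. -/

/-- If `⁅x, y⁆` is central, then powers of `x` and `y` commute up to a power of `⁅x, y⁆`. -/
theorem zpow_mul_zpow_of_commutator_mem_center {E : Type*} [Group E] {x y : E}
    (hc : ⁅x, y⁆ ∈ Subgroup.center E) (m n : ℤ) :
    x ^ m * y ^ n = ⁅x, y⁆ ^ (m * n) * (y ^ n * x ^ m) := by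
  have hcomm : ∀ (k : ℤ) (g : E), Commute (⁅x, y⁆ ^ k) g := fun k g =>
    (show Commute ⁅x, y⁆ g from (Subgroup.mem_center_iff.1 hc g).symm).zpow_left k
  have h1 : SemiconjBy x y (⁅x, y⁆ * y) := by
    simp [SemiconjBy, commutatorElement_def, mul_assoc]
  have h2 : SemiconjBy x (y ^ n) (⁅x, y⁆ ^ n * y ^ n) := by
    have := h1.zpow_right n
    rwa [((by simpa using hcomm 1 y : Commute ⁅x, y⁆ y)).mul_zpow] at this
  have h3 : SemiconjBy (y ^ n) x ((⁅x, y⁆ ^ n)⁻¹ * x) := by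
    have h2' := h2.eq
    rw [SemiconjBy, mul_assoc, h2', mul_assoc, inv_mul_cancel_left]
  have h4 := h3.zpow_right m
  have hc' : Commute (⁅x, y⁆ ^ n)⁻¹ x := (hcomm n x).inv_left
  rw [hc'.mul_zpow, SemiconjBy, inv_zpow, ← zpow_mul, mul_comm n m] at h4
  rw [h4, mul_assoc, mul_inv_cancel_left]

/-- Commutators in a group generated by two elements and the centre, when the commutator of the
two elements is central. -/
theorem commutator_of_commutator_mem_center {E : Type*} [Group E] {x y : E}
    (hc : ⁅x, y⁆ ∈ Subgroup.center E) (s t s' t' : ℤ) {k k' : E}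
    (hk : k ∈ Subgroup.center E) (hk' : k' ∈ Subgroup.center E) :
    ⁅x ^ s * y ^ t * k, x ^ s' * y ^ t' * k'⁆ = ⁅x, y⁆ ^ (s * t' - s' * t) := by
  have key : ∀ (s t s' t' : ℤ) (k k' : E), k ∈ Subgroup.center E → k' ∈ Subgroup.center E →
      x ^ s * y ^ t * k * (x ^ s' * y ^ t' * k') =
        ⁅x, y⁆ ^ (-(s' * t)) * (x ^ (s + s') * y ^ (t + t') * (k * k')) := by
    intro s t s' t' k k' hk hk'
    have hkc : ∀ g, k * g = g * k := fun g => (Subgroup.mem_center_iff.1 hk g).symm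
    have hcc : ∀ (n : ℤ) (g : E), g * ⁅x, y⁆ ^ n = ⁅x, y⁆ ^ n * g := fun n g =>
      Subgroup.mem_center_iff.1 (zpow_mem hc n) g
    have h : y ^ t * x ^ s' = ⁅x, y⁆ ^ (-(s' * t)) * (x ^ s' * y ^ t) := by
      rw [zpow_mul_zpow_of_commutator_mem_center hc s' t, zpow_neg, inv_mul_cancel_left]
    calc x ^ s * y ^ t * k * (x ^ s' * y ^ t' * k')
        = x ^ s * y ^ t * (k * (x ^ s' * y ^ t')) * k' := by group
      _ = x ^ s * (y ^ t * x ^ s') * y ^ t' * (k * k') := by rw [hkc]; group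
      _ = x ^ s * ⁅x, y⁆ ^ (-(s' * t)) * (x ^ s' * y ^ t) * y ^ t' * (k * k') := by
          rw [h]; simp only [mul_assoc]
      _ = _ := by rw [hcc, zpow_add, zpow_add]; simp only [mul_assoc]
  have hkk : k' * k = k * k' := Subgroup.mem_center_iff.1 hk k'
  -- The two orders of multiplication have normal forms differing only in the power of `⁅x, y⁆`.
  rw [commutatorElement_def, mul_assoc _ _ (_)⁻¹, ← mul_inv_rev, mul_inv_eq_iff_eq_mul,
    key s t s' t' k k' hk hk', key s' t' s t k' k hk' hk, hkk, add_comm s', add_comm t',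
    ← mul_assoc (⁅x, y⁆ ^ (s * t' - s' * t)), ← zpow_add]
  congr 2
  ring

/-! ### The Heisenberg group as a large stem extension. -/

/-- The Heisenberg group of upper unitriangular `3 × 3` matrices over `R`. -/
@[ext]
structure Heisenberg (R : Type*) where
  a : R
  b : R
  c : R

namespace Heisenberg

variable {R : Type*} [CommRing R]

instance : Mul (Heisenberg R) := ⟨fun x y => ⟨x.a + y.a, x.b + y.b, x.c + y.c + x.a * y.b⟩⟩
instance : One (Heisenberg R) := ⟨⟨0, 0, 0⟩⟩
instance : Inv (Heisenberg R) := ⟨fun x => ⟨-x.a, -x.b, -x.c + x.a * x.b⟩⟩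

theorem mul_def (x y : Heisenberg R) :
    x * y = ⟨x.a + y.a, x.b + y.b, x.c + y.c + x.a * y.b⟩ := rfl
theorem one_def : (1 : Heisenberg R) = ⟨0, 0, 0⟩ := rfl
theorem inv_def (x : Heisenberg R) : x⁻¹ = ⟨-x.a, -x.b, -x.c + x.a * x.b⟩ := rfl

instance : Group (Heisenberg R) :=
  Group.ofLeftAxioms
    (fun x y z => by simp only [mul_def, mk.injEq]; refine ⟨?_, ?_, ?_⟩ <;> ring)
    (fun x => by simp [mul_def, one_def])
    (fun x => by simp [mul_def, one_def, inv_def])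

/-- The underlying set of the Heisenberg group is `R × R × R`. -/
def equivProd (R : Type*) : Heisenberg R ≃ (R × R) × R where
  toFun x := ((x.a, x.b), x.c)
  invFun p := ⟨p.1.1, p.1.2, p.2⟩

/-- The projection of the Heisenberg group onto `R × R`. -/
def proj (R : Type*) [CommRing R] : Heisenberg R →* Multiplicative (R × R) where
  toFun x := Multiplicative.ofAdd (x.a, x.b)
  map_one' := rfl
  map_mul' _ _ := rfl

/-- The Heisenberg group times `H` is a stem extension of `R × R × H`. -/
theorem isStemExtension_prodMap (R H : Type) [CommRing R] [Group H] :
    IsStemExtension ((proj R).prodMap (MonoidHom.id H)) := by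
  have hker : ∀ x ∈ ((proj R).prodMap (MonoidHom.id H)).ker, x = (⟨0, 0, x.1.c⟩, 1) := by
    rintro ⟨⟨a, b, c⟩, h⟩ hx
    rw [MonoidHom.mem_ker] at hx
    have h1 : (a, b) = (0, 0) := congrArg (fun q => Multiplicative.toAdd q.1) hx
    have h2 : h = 1 := congrArg Prod.snd hx
    simp only [Prod.mk.injEq] at h1
    rw [h1.1, h1.2, h2]
  refine ⟨?_, ?_, ?_⟩
  · rintro ⟨p, h⟩
    exact ⟨(⟨p.toAdd.1, p.toAdd.2, 0⟩, h), rfl⟩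
  · intro x hx
    rw [hker x hx, Subgroup.mem_center_iff]
    rintro ⟨⟨a, b, c⟩, h⟩
    simp [mul_def, add_comm]
  · intro x hx
    have : x = ⁅((⟨x.1.c, 0, 0⟩, 1) : Heisenberg R × H), (⟨0, 1, 0⟩, 1)⁆ := by
      rw [hker x hx]
      simp [commutatorElement_def, mul_def, inv_def, Prod.mul_def, Prod.inv_mk]
    rw [this]
    exact Subgroup.commutator_mem_commutator (Subgroup.mem_top _) (Subgroup.mem_top _)

end Heisenberg

/-! ### Groups with trivial Schur multiplier. -/

/-- The Schur multiplier of `H` is trivial: the kernel of every central extension of `H` meets the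
commutator subgroup of the extension trivially. -/
def HasTrivialSchurMultiplier (H : Type) [Group H] : Prop :=
  ∀ (E : Type) [Group E] (π : E →* H), Function.Surjective π → π.ker ≤ Subgroup.center E →
    π.ker ⊓ commutator E = ⊥

theorem hasTrivialSchurMultiplier_of_subsingleton (H : Type) [Group H] [Subsingleton H] :
    HasTrivialSchurMultiplier H := by
  intro E _ π _ hπ
  have hker : π.ker = ⊤ := by
    ext x
    simp [MonoidHom.mem_ker, Subsingleton.elim (π x) 1]
  rw [hker, top_le_iff] at hπ
  rw [hker, top_inf_eq, commutator_eq_bot_iff_center_eq_top, hπ]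

/-- Lift the generators to `x`, `y`. Modulo the central kernel `x ^ 2` equals both `y ^ 2` and `c =
⁅x, y⁆`; the first makes `x ^ 2` commute with `y`, hence central, and the second then makes `c`
central. So `c ^ 2 = ⁅x ^ 2, y⁆ = 1` and `c` generates the commutator subgroup. Since `c` maps to `a
2 ≠ 1`, this subgroup misses the kernel. -/
theorem hasTrivialSchurMultiplier_quaternionGroup_two :
    HasTrivialSchurMultiplier (QuaternionGroup 2) := by
  intro E _ π hsurj hcen
  obtain ⟨x, hx⟩ := hsurj (.a 1)
  obtain ⟨y, hy⟩ := hsurj (.xa 0)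
  have hform : ∀ g : E, ∃ (s t : ℤ) (k : E), k ∈ Subgroup.center E ∧ g = x ^ s * y ^ t * k := by
    intro g
    have hq : ∀ q : QuaternionGroup 2, ∃ s t : ℕ,
        q = (.a 1) ^ s * (.xa 0) ^ t := by
      have : ∀ q : QuaternionGroup 2, ∃ s : Fin 4, ∃ t : Fin 2,
        q = (.a 1) ^ (s : ℕ) * (.xa 0) ^ (t : ℕ) := by decide
      intro q
      obtain ⟨s, t, h⟩ := this q
      exact ⟨s, t, h⟩
    obtain ⟨s, t, h⟩ := hq (π g)
    refine ⟨s, t, (x ^ s * y ^ t)⁻¹ * g, hcen ?_, by simp only [zpow_natCast, mul_inv_cancel_left]⟩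
    simp [MonoidHom.mem_ker, hx, hy, h]
  have hx2 : x ^ 2 ∈ Subgroup.center E := by
    have hk : x ^ 2 * (y ^ 2)⁻¹ ∈ Subgroup.center E := hcen (by
      rw [MonoidHom.mem_ker, map_mul, map_inv, map_pow, map_pow, hx, hy]; decide)
    have hxy : Commute (x ^ 2) y := by
      have h1 : Commute (x ^ 2 * (y ^ 2)⁻¹) y := (Subgroup.mem_center_iff.1 hk y).symm
      simpa using h1.mul_left ((Commute.refl y).pow_left 2)
    rw [Subgroup.mem_center_iff]
    intro g
    obtain ⟨s, t, k, hk, rfl⟩ := hform g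
    have h1 : Commute (x ^ 2) (x ^ s) := ((Commute.refl x).pow_left 2).zpow_right s
    have h2 : Commute (x ^ 2) k := Subgroup.mem_center_iff.1 hk _
    exact ((h1.mul_right (hxy.zpow_right t)).mul_right h2).eq.symm
  have hπc : π ⁅x, y⁆ = .a 2 := by rw [map_commutatorElement, hx, hy]; decide
  have hc : ⁅x, y⁆ ∈ Subgroup.center E := by
    have : ⁅x, y⁆ * (x ^ 2)⁻¹ ∈ Subgroup.center E := hcen (by
      rw [MonoidHom.mem_ker, map_mul, map_inv, map_pow, hx, hπc]; decide)
    simpa using mul_mem this hx2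
  have hc2 : ⁅x, y⁆ ^ (2 : ℤ) = 1 := by
    have h := zpow_mul_zpow_of_commutator_mem_center hc 2 1
    have h' := Subgroup.mem_center_iff.1 hx2 y
    rw [zpow_one, mul_one, zpow_ofNat, h'] at h
    exact right_eq_mul.1 h
  have hcomm : commutator E ≤ Subgroup.zpowers ⁅x, y⁆ := by
    rw [commutator_def, Subgroup.commutator_le]
    intro g _ g' _
    obtain ⟨s, t, k, hk, rfl⟩ := hform g
    obtain ⟨s', t', k', hk', rfl⟩ := hform g'
    rw [commutator_of_commutator_mem_center hc s t s' t' hk hk']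
    exact ⟨_, rfl⟩
  rw [eq_bot_iff]
  rintro g ⟨hg, hg'⟩
  obtain ⟨n, rfl⟩ := hcomm hg'
  rw [Subgroup.mem_bot]
  obtain ⟨m, rfl | rfl⟩ := n.even_or_odd'
  · simp only [zpow_mul, hc2, one_zpow]
  · exfalso
    simp only [zpow_add, zpow_mul, hc2, one_zpow, one_mul, zpow_one] at hg
    replace hg : π ⁅x, y⁆ = 1 := hg
    rw [hπc] at hg
    exact absurd hg (by decide)

/-- If a power of `x` and a coprime power of `y` are central and so is `⁅x, y⁆`, then `x` and `y`
commute. -/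
theorem commute_of_pow_mem_center_of_coprime {E : Type*} [Group E] {x y : E} {m n : ℕ}
    (hc : ⁅x, y⁆ ∈ Subgroup.center E) (hx : x ^ m ∈ Subgroup.center E)
    (hy : y ^ n ∈ Subgroup.center E) (hmn : m.Coprime n) : Commute x y := by
  have h1 : ⁅x, y⁆ ^ m = 1 := by
    have h := zpow_mul_zpow_of_commutator_mem_center hc m 1
    simp only [zpow_natCast, zpow_one, mul_one, Subgroup.mem_center_iff.1 hx y] at h
    exact right_eq_mul.1 h
  have h2 : ⁅x, y⁆ ^ n = 1 := by
    have h := zpow_mul_zpow_of_commutator_mem_center hc 1 n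
    simp only [zpow_natCast, zpow_one, one_mul, Subgroup.mem_center_iff.1 hy x] at h
    exact right_eq_mul.1 h
  rw [← commutatorElement_eq_one_iff_commute, ← orderOf_eq_one_iff]
  exact Nat.eq_one_of_dvd_coprimes hmn (orderOf_dvd_of_pow_eq_one h1)
    (orderOf_dvd_of_pow_eq_one h2)

/-- Two commuting factors of a product contribute separately to a commutator. -/
theorem commutator_mul_mul_of_commute {E : Type*} [Group E] {g h g' h' : E}
    (hgh' : Commute g h') (hg'h : Commute g' h) (hgh : Commute g h) (hg'h' : Commute g' h') :
    ⁅g * h, g' * h'⁆ = ⁅g, g'⁆ * ⁅h, h'⁆ := by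
  have e1 : g * h * (g' * h') = g * g' * (h * h') := by
    rw [mul_assoc, ← mul_assoc h, ← hg'h.eq]; simp only [mul_assoc]
  have e2 : g' * h' * (g * h) = g' * g * (h' * h) := by
    rw [mul_assoc, ← mul_assoc h', ← hgh'.eq]; simp only [mul_assoc]
  have e3 : Commute (g' * g)⁻¹ (h * h' * (h' * h)⁻¹) :=
    (((hg'h.mul_right hg'h').mul_right (hg'h'.mul_right hg'h).inv_right).mul_left
      ((hgh.mul_right hgh').mul_right (hgh'.mul_right hgh).inv_right)).inv_left
  have hdef : ∀ a b : E, ⁅a, b⁆ = a * b * (b * a)⁻¹ := fun a b => by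
    rw [commutatorElement_def, mul_inv_rev, mul_assoc (a * b)]
  rw [hdef, hdef, hdef, e1, e2, mul_inv_rev (g' * g), ← mul_assoc, mul_assoc (g * g'),
    mul_assoc (g * g'), ← e3.eq, ← mul_assoc]

/-! ### Stem extensions and Schur covers of `(ℤ/N)² × H`. -/

section RankTwo

variable {N : ℕ} {H E : Type} [Group H] [Group E]
  {π : E →* Multiplicative (ZMod N × ZMod N) × H}

/-- In a central extension of `(ℤ/N)² × H`, an element over `(ℤ/N)²` is a product of powers of
lifts of the two generators and a central element. -/
theorem exists_eq_zpow_mul_zpow_mul {x y : E}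
    (hx : π x = (Multiplicative.ofAdd (1, 0), 1)) (hy : π y = (Multiplicative.ofAdd (0, 1), 1))
    {g : E} {s t : ℤ} (hg : π g = (Multiplicative.ofAdd ((s : ZMod N), (t : ZMod N)), 1)) :
    ∃ k ∈ π.ker, g = x ^ s * y ^ t * k := by
  refine ⟨(x ^ s * y ^ t)⁻¹ * g, ?_, by rw [mul_inv_cancel_left]⟩
  rw [MonoidHom.mem_ker, map_mul, map_inv, hg, inv_mul_eq_one, map_mul, map_zpow, map_zpow, hx, hy]
  refine Prod.ext (Multiplicative.toAdd.injective ?_) ?_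
  · simp
  · simp

/-- The kernel of a stem extension of `(ℤ/N)² × H`, where `H` has trivial Schur multiplier and
order prime to `N`, is generated by the commutator of lifts of the generators of `(ℤ/N)²`. -/
theorem IsStemExtension.ker_le_zpowers [Finite H] (hH : HasTrivialSchurMultiplier H)
    (hN : N.Coprime (Nat.card H)) (hπ : IsStemExtension π) {x y : E}
    (hx : π x = (Multiplicative.ofAdd (1, 0), 1)) (hy : π y = (Multiplicative.ofAdd (0, 1), 1)) :
    π.ker ≤ Subgroup.zpowers ⁅x, y⁆ := by
  set A : Subgroup E := ((MonoidHom.snd _ _).comp π).ker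
  set B : Subgroup E := ((MonoidHom.fst _ _).comp π).ker
  have memA : ∀ {g}, g ∈ A ↔ (π g).2 = 1 := Iff.rfl
  have memB : ∀ {g}, g ∈ B ↔ (π g).1 = 1 := Iff.rfl
  have hcker : ⁅x, y⁆ ∈ π.ker := by
    rw [MonoidHom.mem_ker, map_commutatorElement, hx, hy, commutatorElement_eq_one_iff_mul_comm]
    exact Prod.ext (mul_comm _ _) rfl
  have hc := hπ.ker_le_center hcker
  have hAB : ∀ g ∈ A, ∀ h ∈ B, Commute g h := by
    intro g hg h hh
    -- `g` and `h` lie over different factors, so `⁅g, h⁆`, `g ^ N` and `h ^ |H|` all fall in the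
    -- central kernel.
    refine commute_of_pow_mem_center_of_coprime (m := N) (n := Nat.card H)
      (hπ.ker_le_center ?_) (hπ.ker_le_center ?_) (hπ.ker_le_center ?_) hN
    · rw [MonoidHom.mem_ker, map_commutatorElement, commutatorElement_eq_one_iff_mul_comm]
      exact Prod.ext (mul_comm _ _) (by simp [memA.1 hg])
    · rw [MonoidHom.mem_ker, map_pow]
      refine Prod.ext (Multiplicative.toAdd.injective ?_) (by simp [memA.1 hg])
      simp [Prod.ext_iff]
    · rw [MonoidHom.mem_ker, map_pow]
      exact Prod.ext (by simp [memB.1 hh]) (by simp)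
  have hdecomp : ∀ g : E, ∃ a ∈ A, ∃ b ∈ B, g = a * b := by
    intro g
    obtain ⟨b, hb⟩ := hπ.surjective (1, (π g).2)
    exact ⟨g * b⁻¹, by simp [memA, hb], b, by simp [memB, hb], by simp⟩
  have hformA : ∀ g ∈ A, ∃ (s t : ℤ) (k : E), k ∈ Subgroup.center E ∧ g = x ^ s * y ^ t * k := by
    intro g hg
    obtain ⟨s, hs⟩ := ZMod.intCast_surjective (π g).1.toAdd.1
    obtain ⟨t, ht⟩ := ZMod.intCast_surjective (π g).1.toAdd.2
    obtain ⟨k, hk, h⟩ := exists_eq_zpow_mul_zpow_mul hx hy (g := g) (s := s) (t := t)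
      (Prod.ext (by rw [hs, ht]; rfl) hg)
    exact ⟨s, t, k, hπ.ker_le_center hk, h⟩
  have hcomm : commutator E ≤ Subgroup.zpowers ⁅x, y⁆ ⊔ ⁅B, B⁆ := by
    rw [commutator_def, Subgroup.commutator_le]
    intro g _ g' _
    obtain ⟨a, ha, b, hb, rfl⟩ := hdecomp g
    obtain ⟨a', ha', b', hb', rfl⟩ := hdecomp g'
    rw [commutator_mul_mul_of_commute (hAB a ha b' hb') (hAB a' ha' b hb) (hAB a ha b hb)
      (hAB a' ha' b' hb')]
    refine Subgroup.mul_mem_sup ?_ (Subgroup.commutator_mem_commutator hb hb')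
    obtain ⟨s, t, k, hk, rfl⟩ := hformA a ha
    obtain ⟨s', t', k', hk', rfl⟩ := hformA a' ha'
    rw [commutator_of_commutator_mem_center hc s t s' t' hk hk']
    exact ⟨_, rfl⟩
  -- `B` is a central extension of `H` with kernel `π.ker`. It need not be a stem extension, so the
  -- multiplier hypothesis is needed for all central extensions.
  have hBB : π.ker ⊓ ⁅B, B⁆ = ⊥ := by
    have hsurj : Function.Surjective (((MonoidHom.snd _ _).comp π).comp B.subtype) := by
      intro h
      obtain ⟨b, hb⟩ := hπ.surjective (1, h)
      exact ⟨⟨b, by simp [memB, hb]⟩, by simp [hb]⟩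
    have hker : ∀ b : B, b ∈ (((MonoidHom.snd _ _).comp π).comp B.subtype).ker ↔
        (b : E) ∈ π.ker := fun b =>
      ⟨fun h => Prod.ext b.2 h, fun h => congrArg Prod.snd h⟩
    have h := hH B _ hsurj fun b hb => Subgroup.mem_center_iff.2 fun g =>
      Subtype.ext (Subgroup.mem_center_iff.1 (hπ.ker_le_center ((hker b).1 hb)) g)
    rw [eq_bot_iff]
    rintro g ⟨hg, hg'⟩
    rw [← Subgroup.map_subtype_commutator] at hg'
    obtain ⟨b, hb, rfl⟩ := hg'
    have : b ∈ (⊥ : Subgroup B) := h ▸ ⟨(hker b).2 hg, hb⟩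
    rw [Subgroup.mem_bot] at this ⊢
    rw [this, map_one]
  have : (Subgroup.zpowers ⁅x, y⁆).Normal :=
    ⟨fun z hz g => by
      rwa [Subgroup.mem_center_iff.1 (Subgroup.zpowers_le.2 hc hz) g, mul_inv_cancel_right]⟩
  intro k hk
  obtain ⟨z, hz, w, hw, rfl⟩ := Subgroup.mem_sup_of_normal_left.1
    (hcomm (hπ.ker_le_commutator hk))
  have hzk : z ∈ π.ker := (Subgroup.zpowers_le.2 hcker) hz
  have hw1 : w ∈ π.ker ⊓ ⁅B, B⁆ := ⟨(Subgroup.mul_mem_cancel_left _ hzk).1 hk, hw⟩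
  rw [hBB, Subgroup.mem_bot] at hw1
  rwa [hw1, mul_one]

/-- In a Schur cover of `(ℤ/N)² × H`, where `H` has trivial Schur multiplier and order prime to
`N`, lifts of two elements of `(ℤ/N)²` commute iff the determinant of these elements vanishes. -/
theorem IsSchurCover.mul_comm_iff [NeZero N] [Finite H] (hH : HasTrivialSchurMultiplier H)
    (hN : N.Coprime (Nat.card H)) (hπ : IsSchurCover π) {u v : ZMod N × ZMod N} {g h : E}
    (hg : π g = (Multiplicative.ofAdd u, 1)) (hh : π h = (Multiplicative.ofAdd v, 1)) :
    g * h = h * g ↔ u.1 * v.2 = v.1 * u.2 := by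
  obtain ⟨x, hx⟩ := hπ.isStem.surjective (Multiplicative.ofAdd (1, 0), 1)
  obtain ⟨y, hy⟩ := hπ.isStem.surjective (Multiplicative.ofAdd (0, 1), 1)
  have hle := hπ.isStem.ker_le_zpowers hH hN hx hy
  have hc : ⁅x, y⁆ ∈ Subgroup.center E := hπ.isStem.ker_le_center (by
    rw [MonoidHom.mem_ker, map_commutatorElement, hx, hy, commutatorElement_eq_one_iff_mul_comm]
    exact Prod.ext (mul_comm _ _) rfl)
  have hfin := hπ.finite
  have hdvd : orderOf ⁅x, y⁆ ∣ N := by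
    apply orderOf_dvd_of_pow_eq_one
    have hxN : x ^ N ∈ Subgroup.center E := hπ.isStem.ker_le_center (by
      rw [MonoidHom.mem_ker, map_pow, hx]
      refine Prod.ext (Multiplicative.toAdd.injective ?_) (by simp)
      simp [Prod.ext_iff])
    have h := zpow_mul_zpow_of_commutator_mem_center hc N 1
    simp only [zpow_natCast, zpow_one, mul_one, Subgroup.mem_center_iff.1 hxN y] at h
    exact right_eq_mul.1 h
  have hcard : N ≤ orderOf ⁅x, y⁆ := by
    -- Maximality is used only here: the competitor has kernel of order `N`, so `π.ker` has at least
    -- `N` elements.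
    have h1 := hπ.card_le _ _ (Heisenberg.isStemExtension_prodMap (ZMod N) H)
    have h2 : Nat.card E = Nat.card π.ker * (N * N * Nat.card H) := by
      rw [← Subgroup.card_mul_index π.ker, Subgroup.index_ker,
        MonoidHom.range_eq_top.2 hπ.isStem.surjective, Subgroup.card_top, Nat.card_prod,
        Nat.card_congr Multiplicative.toAdd, Nat.card_prod, Nat.card_zmod]
    rw [h2, Nat.card_prod, Nat.card_congr (Heisenberg.equivProd (ZMod N)), Nat.card_prod,
      Nat.card_prod, Nat.card_zmod, mul_right_comm, mul_comm] at h1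
    have hpos : 0 < N * N * Nat.card H :=
      Nat.mul_pos (Nat.mul_pos (NeZero.pos N) (NeZero.pos N)) Nat.card_pos
    calc N ≤ Nat.card π.ker := Nat.le_of_mul_le_mul_right h1 hpos
      _ ≤ Nat.card (Subgroup.zpowers ⁅x, y⁆) :=
        Nat.card_le_card_of_injective _ (Subgroup.inclusion_injective hle)
      _ = orderOf ⁅x, y⁆ := Nat.card_zpowers _
  have hord : orderOf ⁅x, y⁆ = N := le_antisymm (Nat.le_of_dvd (NeZero.pos N) hdvd) hcard
  obtain ⟨a, b⟩ := u
  obtain ⟨c, d⟩ := v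
  obtain ⟨s, rfl⟩ := ZMod.intCast_surjective a
  obtain ⟨t, rfl⟩ := ZMod.intCast_surjective b
  obtain ⟨s', rfl⟩ := ZMod.intCast_surjective c
  obtain ⟨t', rfl⟩ := ZMod.intCast_surjective d
  obtain ⟨k, hk, rfl⟩ := exists_eq_zpow_mul_zpow_mul hx hy hg
  obtain ⟨k', hk', rfl⟩ := exists_eq_zpow_mul_zpow_mul hx hy hh
  rw [← commutatorElement_eq_one_iff_mul_comm, commutator_of_commutator_mem_center hc s t s' t'
    (hπ.isStem.ker_le_center hk) (hπ.isStem.ker_le_center hk'), ← orderOf_dvd_iff_zpow_eq_one,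
    hord, ← ZMod.intCast_zmod_eq_zero_iff_dvd]
  push_cast
  exact sub_eq_zero

end RankTwo

/-! ### Encoding graphs by determinants. -/

/-- Every finite graph is encoded by the vanishing of `2 × 2` determinants over `ℤ/N`, for some
odd `N`. -/
theorem SimpleGraph.exists_zmod_determinant_representation {V : Type*} [Finite V]
    (Γ : SimpleGraph V) :
    ∃ (N : ℕ) (f : V → ZMod N × ZMod N), N ≠ 0 ∧ N.Coprime 2 ∧ Function.Injective f ∧
      ∀ v w, v ≠ w → (Γ.Adj v w ↔ (f v).1 * (f w).2 = (f w).1 * (f v).2) := by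
  classical
  have := Fintype.ofFinite V
  -- The shift by one skips the prime 2, so that `N` is odd.
  let p : V × V → ℕ := fun e => Nat.nth Nat.Prime (Fintype.equivFin (V × V) e + 1)
  have hprime : ∀ e, (p e).Prime := fun e => Nat.prime_nth_prime _
  have hinj : Function.Injective p := fun e e' h =>
    (Fintype.equivFin (V × V)).injective
      (Fin.ext (Nat.succ_injective (Nat.nth_injective Nat.infinite_setOfPred_prime h)))
  have hcop : Pairwise fun e e' => (p e).Coprime (p e') := fun e e' h =>
    (Nat.coprime_primes (hprime e) (hprime e')).2 (hinj.ne h)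
  have hodd : ∀ e, (p e).Coprime 2 := fun e => by
    refine (Nat.coprime_primes (hprime e) Nat.prime_two).2 (ne_of_gt ?_)
    rw [← Nat.nth_prime_zero_eq_two]
    exact Nat.nth_strictMono Nat.infinite_setOfPred_prime (Nat.succ_pos _)
  have hnt : ∀ e, Nontrivial (ZMod (p e)) := fun e => by
    have : Fact (1 < p e) := ⟨(hprime e).one_lt⟩
    infer_instance
  let φ := ZMod.prodEquivPi p hcop
  -- At the prime of `(a, b)`, the determinant for distinct `v`, `w` is nonzero only if `{v, w} =
  -- {a, b}` is a non-edge. On the diagonal `S` vanishes while `F` singles out `a`, which gives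
  -- injectivity without affecting determinants.
  let F : V → ∀ e, ZMod (p e) := fun v e => if v = e.1 ∧ ¬ Γ.Adj e.1 e.2 then 1 else 0
  let S : V → ∀ e, ZMod (p e) := fun v e => if v = e.2 ∧ e.1 ≠ e.2 then 1 else 0
  refine ⟨∏ e, p e, fun v => (φ.symm (F v), φ.symm (S v)),
    Finset.prod_ne_zero_iff.2 fun e _ => (hprime e).ne_zero,
    Nat.Coprime.prod_left fun e _ => hodd e, ?_, ?_⟩
  · intro v w h
    have h1 : F v = F w := φ.symm.injective (congrArg Prod.fst h)
    have h2 := congrFun h1 (v, v)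
    by_contra hne
    simp [F, Ne.symm hne] at h2
  · intro v w hvw
    simp only [← map_mul, φ.symm.injective.eq_iff]
    constructor
    · intro hadj
      funext e
      obtain ⟨a, b⟩ := e
      have hadj' := hadj.symm
      simp only [Pi.mul_apply, F, S]
      split_ifs <;> grind
    · intro h
      by_contra hadj
      have h1 := congrFun h (v, w)
      simp [F, S, hadj, hvw, hvw.symm] at h1

/-! ### Embedding the graph and choosing `H`. -/

/-- The deep commuting graph of `(ℤ/N)² × H`, computed from any Schur cover, contains every graph
encoded by `2 × 2` determinants over `ℤ/N`. -/
theorem SchurCover.isIndContained_deepCommutingGraph {V : Type*} {Γ : SimpleGraph V} {N : ℕ}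
    [NeZero N] {H : Type} [Group H] [Finite H] (hH : HasTrivialSchurMultiplier H)
    (hN : N.Coprime (Nat.card H)) {f : V → ZMod N × ZMod N} (hf : Function.Injective f)
    (hΓ : ∀ v w, v ≠ w → (Γ.Adj v w ↔ (f v).1 * (f w).2 = (f w).1 * (f v).2))
    (C : SchurCover (Multiplicative (ZMod N × ZMod N) × H)) :
    Γ.IsIndContained C.deepCommutingGraph := by
  have hinj : Function.Injective
      fun v => ((Multiplicative.ofAdd (f v), 1) : Multiplicative (ZMod N × ZMod N) × H) :=
    fun v w h => hf (Multiplicative.ofAdd.injective (congrArg Prod.fst h))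
  refine ⟨⟨⟨_, hinj⟩, fun {v w} => ?_⟩⟩
  change (_ ≠ _ ∧ ∀ a b : C.E, C.π a = (Multiplicative.ofAdd (f v), 1) →
    C.π b = (Multiplicative.ofAdd (f w), 1) → a * b = b * a) ↔ _
  constructor
  · rintro ⟨hne, h⟩
    obtain ⟨a, ha⟩ := C.isSchurCover.isStem.surjective (Multiplicative.ofAdd (f v), 1)
    obtain ⟨b, hb⟩ := C.isSchurCover.isStem.surjective (Multiplicative.ofAdd (f w), 1)
    exact (hΓ v w fun hvw => hne (hvw ▸ rfl)).2
      ((C.isSchurCover.mul_comm_iff hH hN ha hb).1 (h a b ha hb))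
  · intro h
    exact ⟨hinj.ne h.ne, fun a b ha hb =>
      (C.isSchurCover.mul_comm_iff hH hN ha hb).2 ((hΓ v w h.ne).1 h)⟩

theorem mainTheorem5 {V : Type*} [Finite V] (Γ : SimpleGraph V) :
    (∃ (G : Type) (_ : Group G) (_ : Finite G), Group.IsNilpotent G ∧
      ∀ C : SchurCover G, Γ.IsIndContained C.deepCommutingGraph) ∧
    (∃ (G : Type) (_ : Group G) (_ : Finite G), (∀ a b : G, a * b = b * a) ∧
      ∀ C : SchurCover G, Γ.IsIndContained C.deepCommutingGraph) ∧
    (∃ (G : Type) (_ : Group G) (_ : Finite G), Group.IsNilpotent G ∧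
      (¬ ∀ a b : G, a * b = b * a) ∧
      ∀ C : SchurCover G, Γ.IsIndContained C.deepCommutingGraph) := by
  obtain ⟨N, f, hN0, hN2, hf, hΓ⟩ := Γ.exists_zmod_determinant_representation
  have : NeZero N := ⟨hN0⟩
  have habelian : ∀ C : SchurCover (Multiplicative (ZMod N × ZMod N) × Unit),
      Γ.IsIndContained C.deepCommutingGraph :=
    SchurCover.isIndContained_deepCommutingGraph
      (hasTrivialSchurMultiplier_of_subsingleton Unit) (by simp) hf hΓ
  refine ⟨⟨_, inferInstance, inferInstance, inferInstance, habelian⟩,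
    ⟨_, inferInstance, inferInstance, mul_comm, habelian⟩,
    ⟨Multiplicative (ZMod N × ZMod N) × QuaternionGroup 2, inferInstance, inferInstance, ?_, ?_,
      SchurCover.isIndContained_deepCommutingGraph
        hasTrivialSchurMultiplier_quaternionGroup_two ?_ hf hΓ⟩⟩
  -- The second factor has order `2 ^ 3`: it is a 2-group, and its order is prime to the odd `N`.
  · have : Group.IsNilpotent (QuaternionGroup 2) :=
      (IsPGroup.of_card (p := 2) (n := 3)
        (by rw [Nat.card_eq_fintype_card, QuaternionGroup.card]; norm_num)).isNilpotent
    infer_instance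
  · intro h
    have h2 : (.a 1 * .xa 0 : QuaternionGroup 2) = .xa 0 * .a 1 :=
      congrArg Prod.snd (h (1, .a 1) (1, .xa 0))
    exact absurd h2 (by decide)
  · rw [Nat.card_eq_fintype_card, QuaternionGroup.card]
    exact Nat.Coprime.pow_right 3 hN2
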